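/- Let $K/F$ be a finite Galois extension of fields with Galois group $G$, $|G|=n$, acting on $K$ on the right and written $k\mapsto k^\sigma$ (so $k^{\sigma\tau}=(k^\sigma)^\tau$). Let $\Phi\colon G\times G\to K\setminus\{0\}$ be a normalized cocycle, that is, $\Phi(\sigma\tau,\rho)\Phi(\sigma,\tau)^\rho=\Phi(\sigma,\tau\rho)\Phi(\tau,\rho)$ and $\Phi(\mathrm{id},\sigma)=\Phi(\sigma,\mathrm{id})=1$, and let $D=(K/F,\Phi)$ be the crossed product: the right $K$-vector space with basis $(e_\sigma)_{\sigma\in G}$ and multiplication $$\Big(\sum_\sigma e_\sigma c_\sigma\Big)\Big(\sum_\tau e_\tau d_\tau\Big)=\sum_{\sigma,\tau}e_{\sigma\tau}\,\Phi(\sigma,\tau)\,c_\sigma^\tau\, d_\tau ,$$ in which $K$ is identified with $e_{\mathrm{id}}K$. Assume that $D$ is a division algebra and that $\ast$ is an involution on $D$ with $K^\ast\subseteq K$. Let $f\colon D\to K$, $f(\sum_\sigma e_\sigma c_\sigma)=c_{\mathrm{id}}$, put $a_\sigma=e_\sigma^\ast e_\sigma$ and $A=[f(e_\sigma^\ast e_\tau)]_{\sigma,\tau\in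 G}\in M_n(K)$, and let $\#$ be the involution $X^\#=A^{-1}X^\ast A$ on $M_n(K)$, where $[x_{\sigma\tau}]^\ast=[x_{\tau\sigma}^\ast]$; thus $(M_n(K),\#)\cong(D\otimes_F K,\ast)$. Let $\lambda\colon D\to M_n(K)$ be the left regular representation, $a e_\tau=\sum_\sigma e_\sigma\lambda(a)_{\sigma\tau}$. Assume that $\#$ is formally real: every nonempty finite sum of nonzero elements of the form $XX^\#$ is nonzero (it follows that $a_\sigma\in K$ for all $\sigma$). A unital hermitian cone on a ring $R$ with involution $s$ is a set $M\subseteq\{r\in R: s(r)=r\}$ with $1\in M$, $M+M\subseteq M$, $rMs(r)\subseteq M$ for all $r\in R$, and $M\cap -M=\{0\}$. Let $N$ be a unital hermitian cone on $(K,\ast)$. Then the following are equivalent: 1. $a_\sigma n^\sigma\in N$ for all $n\in N$ and $\sigma\in G$; 2. $a_\sigma\in N$ and $N_\sigma=N$ for all $\sigma\in G$, where $N_\sigma=\{(n/a_\sigma)^{\sigma^{-1}} : n\in N\}$; 3. $N$ extends to a unital hermitian cone on $(D,\ast)$, i.e. $N=M\cap K$ for some unital hermitian cone $M$ on $(D,\ast)$;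 4. $N$ extends to a unital hermitian cone on $(M_n(K),\#)$, i.e. $N=\lambda^{-1}(L)\cap K$ for some unital hermitian cone $L$ on $(M_n(K),\#)$. -/

import Mathlib

open scoped BigOperators

noncomputable section

/-! ### Involutions, formal reality and hermitian cones -/

/-- An involution `s` on a ring `R` is formally real if every (nonempty) finite sum of nonzero
elements of the form `r * s r` is nonzero. -/
def IsFormallyRealInvolution {R : Type*} [Ring R] (s : R → R) : Prop :=
  ∀ (m : ℕ) (r : Fin (m + 1) → R), (∀ i, r i * s (r i) ≠ 0) → ∑ i, r i * s (r i) ≠ 0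

/-- A unital hermitian cone (`1`-hermitian cone containing `1`) on a ring `R` with
involution `s`: a set `M` of elements with `s a = a` such that `M + M ⊆ M`, `r M s(r) ⊆ M` for all
`r`, `M ∩ -M = {0}` and `1 ∈ M`. -/
structure IsUnitalHermitianCone {R : Type*} [Ring R] (s : R → R) (M : Set R) : Prop where
  hermitian : ∀ a ∈ M, s a = a
  add_mem : ∀ a ∈ M, ∀ b ∈ M, a + b ∈ M
  conj_mem : ∀ r : R, ∀ a ∈ M, r * a * s r ∈ M
  proper : M ∩ {a | -a ∈ M} = {0}
  one_mem : (1 : R) ∈ M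

/-! ### Crossed products

The Galois group acts on `K` from the right in exponential notation, `k ^ σ = σ k`, so that the
product "`στ`" with `k ^ (στ) = (k ^ σ) ^ τ` is the element `τ * σ` of `Gal(K/F)`, since
multiplication there is composition of maps. -/

/-- A normalized cocycle `Φ : G × G → K \ {0}` where `G` is the group of `F`-automorphisms
of `K`. -/
structure NormalizedCocycle (F K : Type*) [Field F] [Field K] [Algebra F K] where
  toFun : (K ≃ₐ[F] K) → (K ≃ₐ[F] K) → K
  ne_zero : ∀ σ τ, toFun σ τ ≠ 0
  cocycle : ∀ σ τ ρ,
    toFun (τ * σ) ρ * ρ (toFun σ τ) = toFun σ (ρ * τ) * toFun τ ρ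
  one_left : ∀ σ, toFun 1 σ = 1
  one_right : ∀ σ, toFun σ 1 = 1

/-- The crossed product `(K/F, Φ)`: the right `K`-vector space with basis `(e σ)`, where
`σ` runs through `Gal(K/F)`. The function `x` stands for `∑ σ, e σ * x σ`. -/
def CrossedProduct {F K : Type*} [Field F] [Field K] [Algebra F K]
    (_Φ : NormalizedCocycle F K) : Type _ :=
  (K ≃ₐ[F] K) → K

namespace CrossedProduct

variable {F K : Type*} [Field F] [Field K] [Algebra F K] {Φ : NormalizedCocycle F K}

instance : AddCommGroup (CrossedProduct Φ) :=
  inferInstanceAs (AddCommGroup ((K ≃ₐ[F] K) → K))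

/-- The coefficient of `x` at the basis vector `e σ`. -/
def coeff (x : CrossedProduct Φ) (σ : K ≃ₐ[F] K) : K := x σ

open Classical in
/-- The element `e σ * c`, where `e σ` is the basis vector and `c` is in `K`. -/
def single (σ : K ≃ₐ[F] K) (c : K) : CrossedProduct Φ :=
  (Pi.single σ c : (K ≃ₐ[F] K) → K)

@[ext] theorem ext {x y : CrossedProduct Φ} (h : ∀ σ, coeff x σ = coeff y σ) : x = y :=
  funext h

@[simp] theorem coeff_add (x y : CrossedProduct Φ) (σ : K ≃ₐ[F] K) :
    coeff (x + y) σ = coeff x σ + coeff y σ := rfl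

@[simp] theorem coeff_zero (σ : K ≃ₐ[F] K) : coeff (0 : CrossedProduct Φ) σ = 0 := rfl

open Classical in
theorem coeff_single (σ τ : K ≃ₐ[F] K) (c : K) :
    coeff (single σ c : CrossedProduct Φ) τ = if τ = σ then c else 0 := by
  simp [coeff, single, Pi.single_apply]

theorem single_add (σ : K ≃ₐ[F] K) (c d : K) :
    (single σ (c + d) : CrossedProduct Φ) = single σ c + single σ d := by
  classical
  ext τ
  simp only [coeff_add, coeff_single]
  split_ifs <;> simp

@[simp] theorem single_zero (σ : K ≃ₐ[F] K) : (single σ 0 : CrossedProduct Φ) = 0 := by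
  classical
  ext τ
  simp [coeff_single]

variable [FiniteDimensional F K]

theorem sum_single (x : CrossedProduct Φ) : ∑ σ, single σ (coeff x σ) = x := by
  classical
  exact Finset.univ_sum_single (M := fun _ : K ≃ₐ[F] K => K) x

/-- The multiplication
`(∑ σ, e σ * c σ) * (∑ τ, e τ * d τ) = ∑ σ τ, e (στ) * (Φ σ τ * (c σ) ^ τ * d τ)`. -/
instance : Mul (CrossedProduct Φ) where
  mul x y := ∑ σ, ∑ τ, single (τ * σ) (Φ.toFun σ τ * τ (coeff x σ) * coeff y τ)

instance : One (CrossedProduct Φ) where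
  one := single 1 1

theorem mul_def (x y : CrossedProduct Φ) :
    x * y = ∑ σ, ∑ τ, single (τ * σ) (Φ.toFun σ τ * τ (coeff x σ) * coeff y τ) := rfl

theorem add_mul' (x y z : CrossedProduct Φ) : (x + y) * z = x * z + y * z := by
  simp only [mul_def, coeff_add, map_add, mul_add, add_mul, single_add, Finset.sum_add_distrib]

theorem mul_add' (x y z : CrossedProduct Φ) : x * (y + z) = x * y + x * z := by
  simp only [mul_def, coeff_add, mul_add, single_add, Finset.sum_add_distrib]

instance : NonUnitalNonAssocRing (CrossedProduct Φ) where
  left_distrib := mul_add'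
  right_distrib := add_mul'
  zero_mul x := by simp [mul_def]
  mul_zero x := by simp [mul_def]

theorem single_mul_single (σ τ : K ≃ₐ[F] K) (c d : K) :
    (single σ c * single τ d : CrossedProduct Φ) =
      single (τ * σ) (Φ.toFun σ τ * τ c * d) := by
  classical
  rw [mul_def, Finset.sum_eq_single σ, Finset.sum_eq_single τ]
  · simp [coeff_single]
  · intro b _ hb
    simp [coeff_single, hb]
  · simp
  · intro b _ hb
    simp [coeff_single, hb]
  · simp

theorem mul_assoc' (x y z : CrossedProduct Φ) : x * y * z = x * (y * z) := by
  rw [← sum_single x, ← sum_single y, ← sum_single z]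
  simp only [Finset.sum_mul, Finset.mul_sum, single_mul_single]
  have key : ∀ σ τ ρ : K ≃ₐ[F] K,
      (single (ρ * (τ * σ)) (Φ.toFun (τ * σ) ρ * ρ (Φ.toFun σ τ * τ (coeff x σ) * coeff y τ)
        * coeff z ρ) : CrossedProduct Φ) =
      single (ρ * τ * σ) (Φ.toFun σ (ρ * τ) * (ρ * τ) (coeff x σ) *
        (Φ.toFun τ ρ * ρ (coeff y τ) * coeff z ρ)) := by
    intro σ τ ρ
    rw [mul_assoc ρ τ σ]
    congr 1
    simp only [map_mul, AlgEquiv.mul_apply]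
    linear_combination (ρ (τ (coeff x σ)) * ρ (coeff y τ) * coeff z ρ) * Φ.cocycle σ τ ρ
  simp only [key]

instance : Ring (CrossedProduct Φ) where
  __ := (inferInstance : NonUnitalNonAssocRing (CrossedProduct Φ))
  __ := (inferInstance : One (CrossedProduct Φ))
  mul_assoc := mul_assoc'
  one_mul x := by
    rw [← sum_single x, Finset.mul_sum]
    simp [show (1 : CrossedProduct Φ) = single 1 1 from rfl, single_mul_single, Φ.one_left]
  mul_one x := by
    rw [← sum_single x, Finset.sum_mul]
    simp [show (1 : CrossedProduct Φ) = single 1 1 from rfl, single_mul_single, Φ.one_right]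

/-- The standard right `K`-basis vectors. -/
def e (σ : K ≃ₐ[F] K) : CrossedProduct Φ := single σ 1

/-- The embedding `K → D`, `k ↦ e 1 * k`, by which `K` is a subfield of `D = (K/F, Φ)`. -/
def incl : K →+* CrossedProduct Φ where
  toFun k := single 1 k
  map_one' := rfl
  map_zero' := single_zero 1
  map_add' := single_add 1
  map_mul' k l := by simp [single_mul_single, Φ.one_left]

theorem eq_sum_e_mul_incl (x : CrossedProduct Φ) : x = ∑ σ, e σ * incl (coeff x σ) := by
  conv_lhs => rw [← sum_single x]
  simp [e, incl, single_mul_single, Φ.one_right]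

theorem incl_mul_e (k : K) (σ : K ≃ₐ[F] K) :
    (incl k * e σ : CrossedProduct Φ) = e σ * incl (σ k) := by
  simp [e, incl, single_mul_single, Φ.one_left, Φ.one_right]

theorem e_mul_e (σ τ : K ≃ₐ[F] K) :
    (e σ * e τ : CrossedProduct Φ) = e (τ * σ) * incl (Φ.toFun σ τ) := by
  simp [e, incl, single_mul_single, Φ.one_right]

/-- The unital `K`-`K`-bilinear map `f : D → K`, `f (∑ σ, e σ * c σ) = c 1`. -/
def f (x : CrossedProduct Φ) : K := coeff x 1

/-- The left regular representation `λ : D → M_n(K)` with respect to the basis `(e σ)`, i.e.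
`a * e τ = ∑ σ, e σ * λ(a) σ τ`. -/
def leftReg (a : CrossedProduct Φ) : Matrix (K ≃ₐ[F] K) (K ≃ₐ[F] K) K :=
  Matrix.of fun σ τ => coeff (a * e τ) σ

theorem mul_e (a : CrossedProduct Φ) (τ : K ≃ₐ[F] K) :
    a * e τ = ∑ σ, e σ * incl (leftReg a σ τ) :=
  eq_sum_e_mul_incl (a * e τ)

/-- The matrix `A = [f ((e σ)^* * e τ)]`. -/
def gram (Φ : NormalizedCocycle F K) [Star (CrossedProduct Φ)] :
    Matrix (K ≃ₐ[F] K) (K ≃ₐ[F] K) K :=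
  Matrix.of fun σ τ => f (star (e σ : CrossedProduct Φ) * e τ)

/-- The involution `X^# = A⁻¹ * X^* * A` on `M_n(K)`, where `X^*` is the conjugate transpose
with respect to the involution of `K`. It extends the involution of `D` along `leftReg`, and
the involution of `K` (embedded as scalar matrices), i.e. it is the extended
involution of `D ⊗ K`. -/
def sharp [DecidableEq (K ≃ₐ[F] K)] (Φ : NormalizedCocycle F K) [Star K] [Star (CrossedProduct Φ)]
    (X : Matrix (K ≃ₐ[F] K) (K ≃ₐ[F] K) K) : Matrix (K ≃ₐ[F] K) (K ≃ₐ[F] K) K :=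
  (gram Φ)⁻¹ * X.conjTranspose * gram Φ

/-- The element `a σ = (e σ)^* * e σ` of `D`. -/
def hermSq (Φ : NormalizedCocycle F K) [Star (CrossedProduct Φ)] (σ : K ≃ₐ[F] K) :
    CrossedProduct Φ :=
  star (e σ) * e σ

/-- The set `N_σ = {(n / a σ) ^ (σ⁻¹) | n ∈ N}` for a subset `N` of `K`, where `a σ` is
regarded as an element of `K` (it lies in `K` whenever `D ⊗ K` is formally real). -/
def twist (Φ : NormalizedCocycle F K) [Star (CrossedProduct Φ)] (N : Set K) (σ : K ≃ₐ[F] K) :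
    Set K :=
  {k | ∃ n ∈ N, ∃ a : K, incl a = hermSq Φ σ ∧ k = σ.symm (n / a)}

end CrossedProduct

end

/-! Applying `*` to `k e_σ = e_σ k^σ` shows that `e_σ^*` lies in a single line `e_ρ K`. The matrix
`A` of the form `f(x^* y)` is hermitian, and it is invertible because `D` is a division algebra.
Formal reality of `#` excludes zeros on its diagonal (`diag_ne_zero`), which forces `ρ = σ⁻¹`; hence
`a_σ ∈ K` and `A = diag(a_σ)`. Since `λ(k) = diag(k^σ)`, the hermitian form of `A λ(k)` is `∑ v_σ^*
(a_σ k^σ) v_σ`, and condition 1 puts all its values in `N` when `k ∈ N`. The matrices `X` for which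
the form of `A X` is `N`-valued therefore make up the cone needed for 4
(`isUnitalHermitianCone_matrixCone`). Pulling back along `λ` gives 3, and `e_σ^* n e_σ = a_σ n^σ`
gives 1 again. Conditions 1 and 2 are linked by `a_{σ⁻¹} (a_σ)^{σ⁻¹} = Φ^* Φ` with `Φ = Φ(σ, σ⁻¹)`.
-/

namespace CrossedProduct

/-! ### Coefficients in the crossed product. -/

section Coefficients

variable {F K : Type*} [Field F] [Field K] [Algebra F K] {Φ : NormalizedCocycle F K}

theorem coeff_sum {ι : Type*} (s : Finset ι) (g : ι → CrossedProduct Φ) (ρ : K ≃ₐ[F] K) :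
    coeff (∑ i ∈ s, g i) ρ = ∑ i ∈ s, coeff (g i) ρ :=
  Finset.sum_apply ρ s g

theorem coeff_single_self (σ : K ≃ₐ[F] K) (c : K) :
    coeff (single σ c : CrossedProduct Φ) σ = c := by
  simp [coeff_single]

theorem coeff_single_of_ne {σ τ : K ≃ₐ[F] K} (h : τ ≠ σ) (c : K) :
    coeff (single σ c : CrossedProduct Φ) τ = 0 := by
  simp [coeff_single, h]

theorem e_one : (e 1 : CrossedProduct Φ) = 1 := rfl

theorem f_one : f (1 : CrossedProduct Φ) = 1 :=
  coeff_single_self 1 1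

variable [FiniteDimensional F K]

theorem incl_apply (k : K) : (incl k : CrossedProduct Φ) = single 1 k := rfl

theorem e_ne_zero (σ : K ≃ₐ[F] K) : (e σ : CrossedProduct Φ) ≠ 0 := by
  intro h
  have := congrArg (fun x => coeff x σ) h
  simp [e, coeff_single_self] at this

theorem coeff_incl_mul (k : K) (x : CrossedProduct Φ) (ρ : K ≃ₐ[F] K) :
    coeff (incl k * x) ρ = ρ k * coeff x ρ := by
  classical
  conv_lhs => rw [← sum_single x, Finset.mul_sum]
  simp [coeff_sum, incl_apply, single_mul_single, Φ.one_left, coeff_single]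

theorem coeff_mul_incl (x : CrossedProduct Φ) (k : K) (ρ : K ≃ₐ[F] K) :
    coeff (x * incl k) ρ = coeff x ρ * k := by
  classical
  conv_lhs => rw [← sum_single x, Finset.sum_mul]
  simp [coeff_sum, incl_apply, single_mul_single, Φ.one_right, coeff_single]

theorem f_sum {ι : Type*} (s : Finset ι) (g : ι → CrossedProduct Φ) :
    f (∑ i ∈ s, g i) = ∑ i ∈ s, f (g i) :=
  coeff_sum s g 1

theorem f_incl (k : K) : f (incl k : CrossedProduct Φ) = k :=
  coeff_single_self 1 k

theorem incl_injective : Function.Injective (incl : K →+* CrossedProduct Φ) :=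
  Function.LeftInverse.injective f_incl

theorem f_incl_mul (k : K) (x : CrossedProduct Φ) : f (incl k * x) = k * f x := by
  simp [f, coeff_incl_mul]

theorem f_mul_incl (x : CrossedProduct Φ) (k : K) : f (x * incl k) = f x * k :=
  coeff_mul_incl x k 1

/-! ### The left regular representation -/

theorem leftReg_add (a b : CrossedProduct Φ) : leftReg (a + b) = leftReg a + leftReg b := by
  ext σ τ
  simp [leftReg, add_mul]

theorem leftReg_mul (a b : CrossedProduct Φ) : leftReg (a * b) = leftReg a * leftReg b := by
  ext σ τ
  rw [Matrix.mul_apply]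
  change coeff (a * b * e τ) σ = _
  rw [mul_assoc, mul_e b τ, Finset.mul_sum, coeff_sum]
  refine Finset.sum_congr rfl fun ρ _ => ?_
  rw [← mul_assoc, coeff_mul_incl]
  rfl

theorem leftReg_injective :
    Function.Injective (leftReg : CrossedProduct Φ → Matrix (K ≃ₐ[F] K) (K ≃ₐ[F] K) K) := by
  intro a b h
  ext σ
  have := congrFun (congrFun h σ) 1
  simpa [leftReg, e_one] using this

theorem leftReg_incl [DecidableEq (K ≃ₐ[F] K)] (k : K) :
    leftReg (incl k : CrossedProduct Φ) = Matrix.diagonal fun σ => σ k := by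
  ext σ τ
  change coeff (incl k * e τ) σ = _
  rw [coeff_incl_mul, Matrix.diagonal_apply]
  split_ifs with h
  · simp [e, h, coeff_single_self]
  · simp [e, coeff_single_of_ne h]

end Coefficients

/-! ### The involution on basis vectors and the form `f(x^* y)`. -/

section Involution

variable {F K : Type*} [Field F] [Field K] [Algebra F K] [FiniteDimensional F K]
  {Φ : NormalizedCocycle F K} [StarRing (CrossedProduct Φ)] [StarRing K]

/-- `star (e σ)` is a scalar multiple of a basis vector. -/
theorem exists_star_e_eq_single
    (hstar : ∀ k : K, star (incl k : CrossedProduct Φ) = incl (star k)) (σ : K ≃ₐ[F] K) :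
    ∃ (ρ : K ≃ₐ[F] K) (c : K), (star (e σ) : CrossedProduct Φ) = single ρ c ∧
      ∀ l, ρ (star (σ l)) = star l := by
  have key : ∀ ρ : K ≃ₐ[F] K, coeff (star (e σ) : CrossedProduct Φ) ρ ≠ 0 →
      ∀ l, ρ (star (σ l)) = star l := by
    intro ρ hρ l
    -- Comparing coefficients at `e_ρ` after applying `*`, a nonzero coefficient can be cancelled.
    have h : star (incl l * e σ : CrossedProduct Φ) = star (e σ * incl (σ l)) := by
      rw [incl_mul_e]
    rw [star_mul, star_mul, hstar, hstar] at h
    have h' := congrArg (fun x => coeff x ρ) h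
    simp only [coeff_mul_incl, coeff_incl_mul] at h'
    rw [mul_comm] at h'
    exact (mul_right_cancel₀ hρ h').symm
  have hne : (star (e σ) : CrossedProduct Φ) ≠ 0 := star_ne_zero.mpr (e_ne_zero σ)
  obtain ⟨ρ, hρ⟩ : ∃ ρ, coeff (star (e σ) : CrossedProduct Φ) ρ ≠ 0 := by
    by_contra! h
    exact hne (ext h)
  refine ⟨ρ, coeff (star (e σ) : CrossedProduct Φ) ρ, ?_, key ρ hρ⟩
  ext τ
  by_cases hτ : τ = ρ
  · rw [hτ, coeff_single_self]
  · rw [coeff_single_of_ne hτ]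
    by_contra h
    refine hτ (AlgEquiv.ext fun k => ?_)
    -- For this `l` the relation computes the value at `k`, so it determines the automorphism.
    have h1 := key τ h (σ.symm (star k))
    have h2 := key ρ hρ (σ.symm (star k))
    rw [σ.apply_symm_apply, star_star] at h1 h2
    rw [h1, h2]

theorem f_star_e (hstar : ∀ k : K, star (incl k : CrossedProduct Φ) = incl (star k))
    {σ : K ≃ₐ[F] K} (hσ : σ ≠ 1) : f (star (e σ) : CrossedProduct Φ) = 0 := by
  obtain ⟨ρ, c, h, hρ⟩ := exists_star_e_eq_single hstar σ
  rw [h]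
  refine coeff_single_of_ne (fun h1 => hσ (AlgEquiv.ext fun l => ?_)) c
  simpa [← h1] using hρ l

theorem f_star (hstar : ∀ k : K, star (incl k : CrossedProduct Φ) = incl (star k))
    (x : CrossedProduct Φ) : f (star x) = star (f x) := by
  conv_lhs => rw [eq_sum_e_mul_incl x]
  rw [star_sum, f_sum, Finset.sum_eq_single 1]
  · rw [star_mul, hstar, f_incl_mul, e_one, star_one, f_one, mul_one]
    rfl
  · intro σ _ hσ
    rw [star_mul, hstar, f_incl_mul, f_star_e hstar hσ, mul_zero]
  · simp

/-! ### The Gram matrix -/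

theorem gram_isHermitian
    (hstar : ∀ k : K, star (incl k : CrossedProduct Φ) = incl (star k)) :
    (gram Φ).IsHermitian := by
  ext σ τ
  simp [gram, ← f_star hstar]

-- In coordinates, `A` is the matrix of the form `f(x^* y)`.
omit [StarRing K] in
theorem sum_gram_mul (σ : K ≃ₐ[F] K) (x : CrossedProduct Φ) :
    ∑ τ, gram Φ σ τ * coeff x τ = f (star (e σ) * x) := by
  conv_rhs => rw [eq_sum_e_mul_incl x, Finset.mul_sum, f_sum]
  refine Finset.sum_congr rfl fun τ _ => ?_
  rw [← mul_assoc, f_mul_incl]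
  rfl

theorem f_star_mul (hstar : ∀ k : K, star (incl k : CrossedProduct Φ) = incl (star k))
    (x y : CrossedProduct Φ) :
    f (star x * y) = ∑ σ, star (coeff x σ) * f (star (e σ) * y) := by
  conv_lhs => rw [eq_sum_e_mul_incl x, star_sum, Finset.sum_mul, f_sum]
  refine Finset.sum_congr rfl fun σ _ => ?_
  rw [star_mul, hstar, mul_assoc, f_incl_mul]

/-- A kernel vector `y` of `A` satisfies `f(x^* y) = 0` for all `x`; taking `x^* = y⁻¹` contradicts
`f(1) = 1`. -/
theorem isUnit_det_gram [DecidableEq (K ≃ₐ[F] K)]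
    (hdiv : ∀ x : CrossedProduct Φ, x ≠ 0 → IsUnit x)
    (hstar : ∀ k : K, star (incl k : CrossedProduct Φ) = incl (star k)) :
    IsUnit (gram Φ).det := by
  rw [isUnit_iff_ne_zero]
  intro h0
  obtain ⟨v, hv, hAv⟩ := Matrix.exists_mulVec_eq_zero_iff.mpr h0
  let y : CrossedProduct Φ := v
  have hy : y ≠ 0 := hv
  obtain ⟨z, hz⟩ := (hdiv y hy).exists_left_inv
  have h1 := f_star_mul hstar (star z) y
  rw [star_star, hz, f_one, Finset.sum_eq_zero] at h1
  · exact one_ne_zero h1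
  · intro σ _
    rw [← sum_gram_mul]
    have := congrFun hAv σ
    rw [Matrix.mulVec, dotProduct] at this
    exact mul_eq_zero_of_right _ this

/-- Both sides are the matrix of `f((a x)^* y) = f(x^* (a^* y))`: left multiplications by `a` and
`a^*` are adjoint. -/
theorem gram_mul_leftReg_star
    (hstar : ∀ k : K, star (incl k : CrossedProduct Φ) = incl (star k))
    (a : CrossedProduct Φ) :
    gram Φ * leftReg (star a) = (leftReg a).conjTranspose * gram Φ := by
  ext σ τ
  rw [Matrix.mul_apply, Matrix.mul_apply]
  trans f (star (e σ) * (star a * e τ))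
  · exact sum_gram_mul σ _
  · rw [← mul_assoc, ← star_mul, f_star_mul hstar]
    rfl

theorem leftReg_star [DecidableEq (K ≃ₐ[F] K)]
    (hdet : IsUnit (gram Φ).det)
    (hstar : ∀ k : K, star (incl k : CrossedProduct Φ) = incl (star k))
    (a : CrossedProduct Φ) : leftReg (star a) = sharp Φ (leftReg a) := by
  rw [sharp, Matrix.mul_assoc, ← gram_mul_leftReg_star hstar,
    Matrix.nonsing_inv_mul_cancel_left _ _ hdet]

end Involution

end CrossedProduct

/-! ### Formal reality and the diagonal of a hermitian matrix. -/

/-- An invertible hermitian matrix with a zero on the diagonal represents both `1` and `-1`, so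
its adjoint involution is not formally real. -/
theorem IsFormallyRealInvolution.diag_ne_zero {ι K : Type*} [Fintype ι] [DecidableEq ι] [Field K]
    [StarRing K] {A : Matrix ι ι K} (hA : A.IsHermitian) (hdet : IsUnit A.det)
    (h2 : (2 : K) ≠ 0)
    (hreal : IsFormallyRealInvolution fun X : Matrix ι ι K => A⁻¹ * X.conjTranspose * A)
    (i : ι) : A i i ≠ 0 := by
  intro hi
  have hrow : ∃ j, A i j ≠ 0 := by
    by_contra! h
    exact hdet.ne_zero (Matrix.det_eq_zero_of_row_eq_zero i h)
  obtain ⟨j, hj⟩ := hrow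
  have hij : i ≠ j := fun h => hj (h ▸ hi)
  have hherm : ∀ k l, star (A k l) = A l k := fun k l => hA.apply l k
  have h2s : star (2 : K) = 2 := star_ofNat 2
  -- every hermitian scalar is represented
  have hrep : ∀ s : K, star s = s → ∃ Y : Matrix ι ι K,
      Y * A * Y.conjTranspose = Matrix.single i i s := by
    intro s hs
    -- The row `v` with `x` at `i` and `1` at `j` gives `v A v^* = x A_ij + A_ji x^* + A_jj`, as
    -- `A_ii = 0`; the choice of `x` makes each cross term `(s - A_jj) / 2`.
    obtain ⟨x, hx⟩ : ∃ x : K, x * A i j = (s - A j j) / 2 :=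
      ⟨(s - A j j) / 2 / A i j, div_mul_cancel₀ _ hj⟩
    have hx' : A j i * star x = (s - A j j) / 2 := by
      rw [← hherm i j, ← star_mul, hx, star_div₀, star_sub, hs, hherm, h2s]
    refine ⟨Matrix.single i i x + Matrix.single i j 1, ?_⟩
    ext k l
    simp only [Matrix.conjTranspose_add, Matrix.conjTranspose_single, Matrix.add_mul,
      Matrix.mul_add, Matrix.single_mul_mul_single, Matrix.add_apply, star_one, one_mul, mul_one,
      hi, mul_zero, zero_mul, hx, hx', Matrix.single_apply]
    split_ifs
    · field_simp
      ring
    · simp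
  obtain ⟨Y, hY⟩ := hrep 1 (star_one K)
  obtain ⟨Z, hZ⟩ := hrep (-1) (by simp)
  have hval : ∀ Y : Matrix ι ι K, (Y * A) * (A⁻¹ * (Y * A).conjTranspose * A) =
      Y * A * Y.conjTranspose * A := by
    intro Y
    rw [Matrix.conjTranspose_mul, hA.eq]
    calc _ = Y * (A * A⁻¹) * A * Y.conjTranspose * A := by simp only [Matrix.mul_assoc]
      _ = _ := by rw [Matrix.mul_nonsing_inv _ hdet, Matrix.mul_one]
  have hne : ∀ s : K, s ≠ 0 → Matrix.single i i s * A ≠ 0 := by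
    intro s hs h
    have := congrFun (congrFun h i) j
    rw [Matrix.single_mul_apply_same] at this
    exact mul_ne_zero hs hj this
  -- For `X = Y A` and `X = Z A`, the products `X X^#` are `E_ii A` and `-E_ii A`: nonzero with sum
  -- zero.
  refine hreal 1 ![Y * A, Z * A] ?_ ?_
  · intro k
    fin_cases k
    · change (Y * A) * (A⁻¹ * (Y * A).conjTranspose * A) ≠ 0
      rw [hval, hY]
      exact hne 1 one_ne_zero
    · change (Z * A) * (A⁻¹ * (Z * A).conjTranspose * A) ≠ 0
      rw [hval, hZ]
      exact hne (-1) (neg_ne_zero.mpr one_ne_zero)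
  · rw [Fin.sum_univ_two]
    simp only [Matrix.cons_val_zero, Matrix.cons_val_one, hval, hY, hZ]
    rw [← Matrix.add_mul, ← Matrix.single_add]
    simp

/-! ### Generalities on hermitian cones. -/

namespace IsUnitalHermitianCone

theorem zero_mem {R : Type*} [Ring R] {s : R → R} {M : Set R} (hM : IsUnitalHermitianCone s M) :
    (0 : R) ∈ M :=
  (hM.proper.symm ▸ Set.mem_singleton (0 : R) : (0 : R) ∈ M ∩ {a | -a ∈ M}).1

theorem eq_zero {R : Type*} [Ring R] {s : R → R} {M : Set R} (hM : IsUnitalHermitianCone s M)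
    {a : R} (h : a ∈ M) (h' : -a ∈ M) : a = 0 :=
  hM.proper.subset ⟨h, h'⟩

theorem sum_mem {R ι : Type*} [Ring R] {s : R → R} {M : Set R} (hM : IsUnitalHermitianCone s M)
    (t : Finset ι) (g : ι → R) (hg : ∀ i ∈ t, g i ∈ M) : ∑ i ∈ t, g i ∈ M :=
  Finset.sum_induction g (· ∈ M) (fun a b ha hb => hM.add_mem a ha b hb) hM.zero_mem hg

theorem two_ne_zero {R : Type*} [Ring R] [Nontrivial R] {s : R → R} {M : Set R}
    (hM : IsUnitalHermitianCone s M) : (2 : R) ≠ 0 := by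
  intro h
  refine one_ne_zero (hM.eq_zero hM.one_mem ?_)
  rw [← one_add_one_eq_two] at h
  rw [← eq_neg_of_add_eq_zero_left h]
  exact hM.one_mem

/-- The preimage of a cone under an injective homomorphism of rings with involution. -/
theorem preimage {R S : Type*} [Ring R] [Ring S] {s : R → R} {t : S → S} {L : Set S}
    (hL : IsUnitalHermitianCone t L) (φ : R →+* S) (hφ : Function.Injective φ)
    (hs : ∀ r, φ (s r) = t (φ r)) : IsUnitalHermitianCone s (φ ⁻¹' L) where
  hermitian a ha := hφ (by rw [hs, hL.hermitian _ ha])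
  add_mem a ha b hb := by
    rw [Set.mem_preimage, map_add]
    exact hL.add_mem _ ha _ hb
  conj_mem r a ha := by
    rw [Set.mem_preimage, map_mul, map_mul, hs]
    exact hL.conj_mem _ _ ha
  proper := by
    ext a
    constructor
    · rintro ⟨h, h'⟩
      refine hφ ?_
      rw [map_zero]
      exact hL.eq_zero h (by simpa using h')
    · rintro rfl
      simp [hL.zero_mem]
  one_mem := by
    rw [Set.mem_preimage, map_one]
    exact hL.one_mem

end IsUnitalHermitianCone

/-! ### The cone of matrices with `N`-valued forms. -/

section MatrixCone

variable {ι K : Type*} [Fintype ι] [DecidableEq ι] [Field K] [StarRing K]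

/-- The matrices `X`, hermitian with respect to the adjoint involution of `A`, whose associated
hermitian form `v ↦ v^* A X v` takes all its values in `N`. -/
def matrixCone (A : Matrix ι ι K) (N : Set K) : Set (Matrix ι ι K) :=
  {X | (A * X).IsHermitian ∧ ∀ v : ι → K, star v ⬝ᵥ (A * X).mulVec v ∈ N}

theorem star_dotProduct_diagonal_mulVec (d v : ι → K) :
    star v ⬝ᵥ (Matrix.diagonal d).mulVec v = ∑ i, star (v i) * d i * star (star (v i)) := by
  simp [dotProduct, Matrix.mulVec_diagonal, mul_assoc]

/-- Polarization. -/
theorem Matrix.IsHermitian.eq_zero_of_forall_dotProduct {H : Matrix ι ι K} (hH : H.IsHermitian)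
    (h2 : (2 : K) ≠ 0) (h : ∀ v : ι → K, star v ⬝ᵥ H.mulVec v = 0) : H = 0 := by
  have hpol : ∀ v w : ι → K, star v ⬝ᵥ H.mulVec w + star w ⬝ᵥ H.mulVec v = 0 := by
    intro v w
    have := h (v + w)
    simp only [star_add, Matrix.mulVec_add, add_dotProduct, dotProduct_add, h] at this
    simpa [add_comm] using this
  have hent : ∀ (i j : ι) (x y : K),
      star (Pi.single i x : ι → K) ⬝ᵥ H.mulVec (Pi.single j y) = star x * H i j * y := by
    intro i j x y
    rw [← Pi.single_star, single_dotProduct, Matrix.mulVec_single]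
    simp [mul_assoc]
  ext i j
  by_contra hne
  rw [Matrix.zero_apply] at hne
  -- The scaling makes both cross terms equal to `1`, so `2 = 0`.
  have h1 := hpol (Pi.single i 1) (Pi.single j (H i j)⁻¹)
  rw [hent, hent, ← hH.apply i j] at h1
  have h3 : star (H j i) ≠ 0 := by rwa [hH.apply i j]
  rw [star_one, one_mul, mul_one, mul_inv_cancel₀ h3, star_inv₀, star_star,
    inv_mul_cancel₀ (star_ne_zero.mp h3), one_add_one_eq_two] at h1
  exact h2 h1

theorem isUnitalHermitianCone_matrixCone {A : Matrix ι ι K} {N : Set K}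
    (hA : A.IsHermitian) (hdet : IsUnit A.det)
    (hN : IsUnitalHermitianCone (star : K → K) N)
    (hAN : ∀ v : ι → K, star v ⬝ᵥ A.mulVec v ∈ N) :
    IsUnitalHermitianCone (fun X : Matrix ι ι K => A⁻¹ * X.conjTranspose * A)
      (matrixCone A N) where
  hermitian X hX := by
    have h : X.conjTranspose * A = A * X := by
      rw [← hX.1.eq, Matrix.conjTranspose_mul, hA.eq]
    change A⁻¹ * X.conjTranspose * A = X
    rw [Matrix.mul_assoc, h, Matrix.nonsing_inv_mul_cancel_left _ _ hdet]
  add_mem X hX Y hY := by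
    refine ⟨?_, fun v => ?_⟩
    · rw [Matrix.mul_add]
      exact hX.1.add hY.1
    · rw [Matrix.mul_add, Matrix.add_mulVec, dotProduct_add]
      exact hN.add_mem _ (hX.2 v) _ (hY.2 v)
  conj_mem Y X hX := by
    -- Thus the form attached to `Y X Y^#` at `v` is the one attached to `X` at `Y^# v`.
    have h : A * (Y * X * (A⁻¹ * Y.conjTranspose * A)) =
        (A⁻¹ * Y.conjTranspose * A).conjTranspose * (A * X) * (A⁻¹ * Y.conjTranspose * A) := by
      simp only [Matrix.conjTranspose_mul, Matrix.conjTranspose_conjTranspose, hA.eq,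
        Matrix.conjTranspose_nonsing_inv]
      simp only [Matrix.mul_assoc, Matrix.nonsing_inv_mul_cancel_left _ _ hdet]
    refine ⟨?_, fun v => ?_⟩
    · rw [h]
      exact Matrix.isHermitian_conjTranspose_mul_mul _ hX.1
    · rw [h]
      have := hX.2 ((A⁻¹ * Y.conjTranspose * A).mulVec v)
      rwa [Matrix.star_mulVec, ← Matrix.dotProduct_mulVec, Matrix.mulVec_mulVec,
        Matrix.mulVec_mulVec] at this
  proper := by
    ext X
    constructor
    · rintro ⟨h, h'⟩
      have h0 : A * X = 0 := by
        refine h.1.eq_zero_of_forall_dotProduct hN.two_ne_zero fun v => ?_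
        refine hN.eq_zero (h.2 v) ?_
        have := h'.2 v
        rwa [Matrix.mul_neg, Matrix.neg_mulVec, dotProduct_neg] at this
      rw [Set.mem_singleton_iff, ← Matrix.nonsing_inv_mul_cancel_left A X hdet, h0,
        Matrix.mul_zero]
    · rintro rfl
      simp [matrixCone, hN.zero_mem]
  one_mem := by
    refine ⟨?_, ?_⟩ <;> rw [Matrix.mul_one]
    · exact hA
    · exact hAN

end MatrixCone

namespace CrossedProduct

/-! ### Diagonal form of the Gram matrix. -/

section FormallyReal

variable {F K : Type*} [Field F] [Field K] [Algebra F K] [FiniteDimensional F K]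
  {Φ : NormalizedCocycle F K} [StarRing (CrossedProduct Φ)] [StarRing K]

/-- Write `e_σ^* = e_ρ c`. Then `e_σ^* e_τ ∈ e_{ρτ} K`, so a nonzero diagonal entry forces `ρ =
σ⁻¹`, and `ρτ` is the identity only for `τ = σ`. -/
theorem star_e_mul_e_of_gram_ne_zero
    (hstar : ∀ k : K, star (incl k : CrossedProduct Φ) = incl (star k))
    {σ : K ≃ₐ[F] K} (hσ : gram Φ σ σ ≠ 0) :
    hermSq Φ σ = incl (gram Φ σ σ) ∧ ∀ τ, τ ≠ σ → gram Φ σ τ = 0 := by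
  obtain ⟨ρ, c, h, -⟩ := exists_star_e_eq_single hstar σ
  have hmul : ∀ τ, (star (e σ) * e τ : CrossedProduct Φ) =
      single (τ * ρ) (Φ.toFun ρ τ * τ c * 1) := by
    intro τ
    rw [h, e, single_mul_single]
  have hg : ∀ τ, gram Φ σ τ = coeff (star (e σ) * e τ : CrossedProduct Φ) 1 := fun _ => rfl
  have h1 : σ * ρ = 1 := by
    by_contra hne
    rw [hg, hmul, coeff_single_of_ne (Ne.symm hne)] at hσ
    exact hσ rfl
  refine ⟨?_, fun τ hτ => ?_⟩
  · rw [hg, hermSq, hmul, h1, coeff_single_self, incl_apply]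
  · rw [hg, hmul]
    refine coeff_single_of_ne (fun h2 => hτ ?_) _
    exact mul_right_cancel (h2.symm.trans h1.symm)

/-- `a τ (a σ) ^ τ = Φ(σ, τ)^* Φ(σ, τ)` for `στ = 1`. -/
theorem mul_apply_gram_symm
    (hstar : ∀ k : K, star (incl k : CrossedProduct Φ) = incl (star k))
    (ha : ∀ σ, hermSq Φ σ = incl (gram Φ σ σ)) (σ : K ≃ₐ[F] K) :
    gram Φ σ⁻¹ σ⁻¹ * σ⁻¹ (gram Φ σ σ) =
      star (Φ.toFun σ σ⁻¹) * Φ.toFun σ σ⁻¹ := by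
  apply incl_injective (Φ := Φ)
  have h : (e σ * e σ⁻¹ : CrossedProduct Φ) = incl (Φ.toFun σ σ⁻¹) := by
    rw [e_mul_e, inv_mul_cancel, e_one, one_mul]
  rw [map_mul, map_mul, ← hstar, ← h, star_mul, ← ha]
  calc hermSq Φ σ⁻¹ * incl (σ⁻¹ (gram Φ σ σ))
      = star (e σ⁻¹) * (incl (gram Φ σ σ) * e σ⁻¹) := by
        rw [incl_mul_e, hermSq, mul_assoc]
    _ = star (e σ⁻¹) * star (e σ) * (e σ * e σ⁻¹) := by
        rw [← ha, hermSq]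
        simp only [mul_assoc]

/-- The left regular representation as a ring homomorphism. -/
noncomputable def leftRegHom [DecidableEq (K ≃ₐ[F] K)] (Φ : NormalizedCocycle F K) :
    CrossedProduct Φ →+* Matrix (K ≃ₐ[F] K) (K ≃ₐ[F] K) K where
  toFun := leftReg
  map_one' := by
    rw [← map_one (incl : K →+* CrossedProduct Φ), leftReg_incl]
    simp
  map_mul' := leftReg_mul
  map_zero' := by
    rw [← map_zero (incl : K →+* CrossedProduct Φ), leftReg_incl]
    simp
  map_add' := leftReg_add

end FormallyReal

end CrossedProduct

/-! ### The equivalences. -/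

theorem mainTheorem7 {F K : Type*} [Field F] [Field K] [Algebra F K]
    [FiniteDimensional F K] [IsGalois F K] [DecidableEq (K ≃ₐ[F] K)]
    (Φ : NormalizedCocycle F K)
    -- `D = (K/F, Φ)` is a division algebra
    (hdiv : ∀ x : CrossedProduct Φ, x ≠ 0 → IsUnit x)
    -- with an involution `*` that maps `K` to itself
    [StarRing (CrossedProduct Φ)] [StarRing K]
    (hstar : ∀ k : K, star (CrossedProduct.incl k : CrossedProduct Φ) =
      CrossedProduct.incl (star k))
    -- such that `(D ⊗ K, *) ≅ (M_n(K), #)` is formally real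
    (hreal : IsFormallyRealInvolution (CrossedProduct.sharp Φ))
    (N : Set K) (hN : IsUnitalHermitianCone (star : K → K) N) :
    List.TFAE [
      ∀ n ∈ N, ∀ σ : K ≃ₐ[F] K,
        CrossedProduct.hermSq Φ σ * CrossedProduct.incl (σ n) ∈
          (CrossedProduct.incl : K →+* CrossedProduct Φ) '' N,
      (∀ σ : K ≃ₐ[F] K,
        CrossedProduct.hermSq Φ σ ∈ (CrossedProduct.incl : K →+* CrossedProduct Φ) '' N) ∧
        ∀ σ : K ≃ₐ[F] K, CrossedProduct.twist Φ N σ = N,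
      ∃ M : Set (CrossedProduct Φ),
        IsUnitalHermitianCone (star : CrossedProduct Φ → CrossedProduct Φ) M ∧
          N = {k | CrossedProduct.incl k ∈ M},
      ∃ L : Set (Matrix (K ≃ₐ[F] K) (K ≃ₐ[F] K) K),
        IsUnitalHermitianCone (CrossedProduct.sharp Φ) L ∧
          N = {k | CrossedProduct.leftReg (CrossedProduct.incl k : CrossedProduct Φ) ∈ L}] := by
  have h2 : (2 : K) ≠ 0 := hN.two_ne_zero
  have hA := CrossedProduct.gram_isHermitian hstar
  have hdet := CrossedProduct.isUnit_det_gram hdiv hstar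
  have hdiag : ∀ σ, CrossedProduct.gram Φ σ σ ≠ 0 :=
    IsFormallyRealInvolution.diag_ne_zero hA hdet h2 hreal
  have ha : ∀ σ, CrossedProduct.hermSq Φ σ = CrossedProduct.incl (CrossedProduct.gram Φ σ σ) :=
    fun σ => (CrossedProduct.star_e_mul_e_of_gram_ne_zero hstar (hdiag σ)).1
  have hgram : CrossedProduct.gram Φ = Matrix.diagonal fun σ => CrossedProduct.gram Φ σ σ := by
    ext σ τ
    rw [Matrix.diagonal_apply]
    split_ifs with h
    · rw [h]
    · exact (CrossedProduct.star_e_mul_e_of_gram_ne_zero hstar (hdiag σ)).2 τ (Ne.symm h)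
  have hinj := CrossedProduct.incl_injective (Φ := Φ)
  have hmem : ∀ k : K, (CrossedProduct.incl k : CrossedProduct Φ) ∈
      (CrossedProduct.incl : K →+* CrossedProduct Φ) '' N ↔ k ∈ N :=
    fun k => hinj.mem_set_image
  have htwist : ∀ σ k, k ∈ CrossedProduct.twist Φ N σ ↔
      CrossedProduct.gram Φ σ σ * σ k ∈ N := by
    intro σ k
    constructor
    · rintro ⟨n, hn, a, haσ, rfl⟩
      rw [ha] at haσ
      rwa [hinj haσ, σ.apply_symm_apply, mul_div_cancel₀ _ (hdiag σ)]
    · intro h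
      refine ⟨_, h, _, (ha σ).symm, ?_⟩
      rw [mul_div_cancel_left₀ _ (hdiag σ), σ.symm_apply_apply]
  simp only [ha, ← map_mul, hmem]
  tfae_have 1 → 2 := by
    intro h
    refine ⟨fun σ => by simpa using h 1 hN.one_mem σ, fun σ => Set.ext fun k => ?_⟩
    rw [htwist]
    refine ⟨fun hk => ?_, fun hk => h k hk σ⟩
    -- Condition 1 for `a_σ k^σ` and `σ⁻¹` gives `Φ^* Φ k ∈ N`; conjugating by `Φ⁻¹` recovers `k`.
    have h1 := h _ hk σ⁻¹
    rw [map_mul, ← mul_assoc, CrossedProduct.mul_apply_gram_symm hstar ha] at h1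
    have h3 := hN.conj_mem (Φ.toFun σ σ⁻¹)⁻¹ _ h1
    have h4 : σ⁻¹ (σ k) = k := σ.symm_apply_apply k
    have h5 := Φ.ne_zero σ σ⁻¹
    have h6 : star (Φ.toFun σ σ⁻¹) ≠ 0 := star_ne_zero.mpr h5
    rw [h4, star_inv₀] at h3
    convert h3 using 1
    field_simp
  tfae_have 2 → 1 := by
    rintro ⟨-, h⟩ n hn σ
    rw [← htwist, h]
    exact hn
  tfae_have 3 → 1 := by
    rintro ⟨M, hM, rfl⟩ n hn σ
    -- `e_σ^* n e_σ = e_σ^* e_σ n^σ = a_σ n^σ`.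
    have := hM.conj_mem (star (CrossedProduct.e σ)) _ hn
    rw [star_star, mul_assoc, CrossedProduct.incl_mul_e, ← mul_assoc] at this
    rw [Set.mem_ofPred_eq, map_mul, ← ha]
    exact this
  tfae_have 4 → 3 := by
    rintro ⟨L, hL, hNL⟩
    exact ⟨_, hL.preimage (CrossedProduct.leftRegHom Φ) CrossedProduct.leftReg_injective
      (CrossedProduct.leftReg_star hdet hstar), hNL⟩
  tfae_have 1 → 4 := by
    intro h
    have hd : ∀ k ∈ N, ∀ v : (K ≃ₐ[F] K) → K, star v ⬝ᵥ (Matrix.diagonal fun σ : K ≃ₐ[F] K =>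
        CrossedProduct.gram Φ σ σ * σ k).mulVec v ∈ N := by
      intro k hk v
      rw [star_dotProduct_diagonal_mulVec]
      exact hN.sum_mem _ _ fun σ _ => hN.conj_mem _ _ (h k hk σ)
    have hprod : ∀ k : K, CrossedProduct.gram Φ *
        CrossedProduct.leftReg (CrossedProduct.incl k : CrossedProduct Φ) =
        Matrix.diagonal fun σ : K ≃ₐ[F] K => CrossedProduct.gram Φ σ σ * σ k := by
      intro k
      rw [CrossedProduct.leftReg_incl]
      conv_lhs => rw [hgram]
      rw [Matrix.diagonal_mul_diagonal]
    refine ⟨matrixCone (CrossedProduct.gram Φ) N,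
      isUnitalHermitianCone_matrixCone hA hdet hN fun v => ?_, Set.ext fun k => ⟨fun hk => ?_,
        fun hk => ?_⟩⟩
    · rw [hgram]
      simpa using hd 1 hN.one_mem v
    · refine ⟨?_, ?_⟩ <;> rw [hprod]
      · rw [Matrix.isHermitian_diagonal_iff]
        exact fun σ => hN.hermitian _ (h k hk σ)
      · exact hd k hk
    · have hv := hk.2 (Pi.single 1 1)
      have h1 : CrossedProduct.gram Φ 1 1 = 1 := by
        simp [CrossedProduct.gram, CrossedProduct.e_one, CrossedProduct.f_one]
      rw [hprod, star_dotProduct_diagonal_mulVec, Finset.sum_eq_single 1] at hv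
      · simpa [h1] using hv
      · intro σ _ hσ
        simp [hσ]
      · simp
  tfae_finish
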